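/- Let $R>0$, $h>0$, $\alpha=2\pi/h$. In the cylinder $\{x_1^2+x_2^2<R^2\}$, with period $h$ in $x_3$, consider the nonzero divergence-free fields $\Phi$ (smooth inside, continuous up to the boundary) with $$\operatorname{curl}\Phi=\lambda\Phi,\qquad \Phi\cdot N=0 \text{ on } x_1^2+x_2^2=R^2,\qquad \Phi=(\Phi_r(r),\Phi_\theta(r),\Phi_z(r))\,e^{in_2\theta}e^{i\alpha n_3z}$$ (components in the cylindrical frame), where $n_2\in\mathbb Z$, $n_3\in\mathbb Z\setminus\{0\}$, $\lambda\in\mathbb R\setminus\{0\}$. For given $(n_2,n_3)$, the eigenvalues $\lambda$ of each sign (polarity) are numbered $n_1=1,2,\dots$ by increasing modulus. A mode is an index $n=(n_1,n_2,n_3)$ together with an eigenvalue $\lambda_n$ of either polarity having that index, and $|n|^2=n_1^2+n_2^2+n_3^2$. The set $K^*=K^*(h/R)$ of strict three-wave resonances consists of the triads $(k,m,n)$ of modes with $$\pm\frac{k_3}{\lambda_k}\pm\frac{m_3}{\lambda_m}\pm\frac{n_3}{\lambda_n}=0\ \text{ for some choice of signs},\qquad k_3m_3n_3\ne0,\quad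 n_3=k_3+m_3,\quad n_2=k_2+m_2.$$ **Proposition.** For all $\eta>0$ and $\varepsilon>0$ there is a ratio $\rho>0$ such that for every cylinder with $h/R=\rho$ there is a triad $(k,m,n)\in K^*$ with $$|k|^2,\ |m|^2,\ |n|^2\ \ge\ \frac1{\eta^2},$$ $$\lambda_k>\lambda_m>\lambda_n,\qquad \lambda_k\lambda_n<0,\qquad |\lambda_m|\le\varepsilon\,\lambda_k,\qquad \left|\frac{|\lambda_n|}{\lambda_k}-1\right|\le\varepsilon .$$ Moreover the triad can be chosen so that the signs in the resonance relation are the ones dictated by the polarities, that is, $\frac{k_3}{\lambda_k}+\frac{m_3}{\lambda_m}=\frac{n_3}{\lambda_n}$. -/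

import Mathlib

open scoped ContDiff

namespace Cylinder

/-- Points of physical space `ℝ³`. -/
abbrev Point : Type := Fin 3 → ℝ

/-- Complex vector fields on `ℝ³`, in Cartesian components. -/
abbrev Field : Type := Point → Fin 3 → ℂ

/-- The partial derivative `∂ Uᵢ / ∂ xⱼ` at `x`. -/
noncomputable def partialDeriv (U : Field) (i j : Fin 3) (x : Point) : ℂ :=
  fderiv ℝ (fun y => U y i) x (Pi.single j 1)

/-- The curl of a vector field. -/
noncomputable def curl (U : Field) (x : Point) : Fin 3 → ℂ :=
  ![partialDeriv U 2 1 x - partialDeriv U 1 2 x,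
    partialDeriv U 0 2 x - partialDeriv U 2 0 x,
    partialDeriv U 1 0 x - partialDeriv U 0 1 x]

/-- The divergence of a vector field. -/
noncomputable def divergence (U : Field) (x : Point) : ℂ :=
  partialDeriv U 0 0 x + partialDeriv U 1 1 x + partialDeriv U 2 2 x

/-- The open solid cylinder of radius `R` around the third axis. Fields are `h`-periodic in the
axial variable, so they are considered on the axially unbounded cylinder. -/
def openCyl (R : ℝ) : Set Point := {x | x 0 ^ 2 + x 1 ^ 2 < R ^ 2}

/-- The closed solid cylinder of radius `R`. -/
def closedCyl (R : ℝ) : Set Point := {x | x 0 ^ 2 + x 1 ^ 2 ≤ R ^ 2}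

/-- The lateral boundary of the cylinder. -/
def lateral (R : ℝ) : Set Point := {x | x 0 ^ 2 + x 1 ^ 2 = R ^ 2}

/-- The rotation by the angle `θ` around the third axis. -/
noncomputable def rotation (θ : ℝ) : Matrix (Fin 3) (Fin 3) ℝ :=
  !![Real.cos θ, -Real.sin θ, 0; Real.sin θ, Real.cos θ, 0; 0, 0, 1]

/-- The basic axial wave number `α = 2π / h`. -/
noncomputable def axialUnit (h : ℝ) : ℝ := 2 * Real.pi / h

/-- `Φ` is a curl eigenfunction, with eigenvalue `lam`, of the cylinder of radius `R` and axial
period `h`, with azimuthal wave number `n₂` and axial wave number `n₃`. -/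
structure IsCurlEigenfunction (h R : ℝ) (n₂ n₃ : ℤ) (lam : ℝ) (Φ : Field) : Prop where
  smooth : ContDiffOn ℝ ∞ Φ (openCyl R)
  continuousOn : ContinuousOn Φ (closedCyl R)
  divergence_eq : ∀ x ∈ openCyl R, divergence Φ x = 0
  curl_eq : ∀ x ∈ openCyl R, curl Φ x = (lam : ℂ) • Φ x
  /-- The normal component vanishes on the lateral boundary. -/
  zero_flux : ∀ x ∈ lateral R, (x 0 : ℂ) * Φ x 0 + (x 1 : ℂ) * Φ x 1 = 0
  /-- In the cylindrical frame `(e_r, e_θ, e_z)`, the field is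
  `(Φ_r(r), Φ_θ(r), Φ_z(r)) exp(i n₂ θ) exp(i α n₃ z)`: a rotation by `θ` and an axial translation
  by `z` multiply the (rotated) field by the corresponding phase. -/
  equivariant : ∀ (θ z : ℝ), ∀ x ∈ closedCyl R,
    Φ ((rotation θ).mulVec x + z • Pi.single 2 1) =
      Complex.exp (Complex.I * ((n₂ * θ + axialUnit h * n₃ * z : ℝ) : ℂ)) •
        ((rotation θ).map Complex.ofReal).mulVec (Φ x)
  nontrivial : ∃ x ∈ openCyl R, Φ x ≠ 0

/-- `lam` is a nonzero eigenvalue of the curl operator with azimuthal and axial wave numbers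
`n₂`, `n₃`. -/
def IsCurlEigenvalue (h R : ℝ) (n₂ n₃ : ℤ) (lam : ℝ) : Prop :=
  lam ≠ 0 ∧ ∃ Φ : Field, IsCurlEigenfunction h R n₂ n₃ lam Φ

/-- `lam` is, among the curl eigenvalues of its own sign (its polarity) with wave numbers
`n₂`, `n₃`, the `n₁`-th one in order of increasing modulus, `n₁ = 1, 2, 3, …`: exactly `n₁`
eigenvalues of that sign have modulus at most `|lam|`. -/
def IsNthCurlEigenvalue (h R : ℝ) (n₁ : ℕ) (n₂ n₃ : ℤ) (lam : ℝ) : Prop :=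
  IsCurlEigenvalue h R n₂ n₃ lam ∧
    {μ : ℝ | IsCurlEigenvalue h R n₂ n₃ μ ∧ 0 < μ * lam ∧ |μ| ≤ |lam|}.encard = (n₁ : ℕ∞)

/-- A vorticity wave with nonzero axial wave number (hence with zero vertical mean): its index
`n = (n₁, n₂, n₃)` and one of the two signed curl eigenvalues `lam` with that index. -/
structure Mode (h R : ℝ) where
  n₁ : ℕ
  n₂ : ℤ
  n₃ : ℤ
  lam : ℝ
  n₃_ne_zero : n₃ ≠ 0
  isNth : IsNthCurlEigenvalue h R n₁ n₂ n₃ lam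

/-- `|n|² = n₁² + n₂² + n₃²`. -/
def Mode.normSq {h R : ℝ} (n : Mode h R) : ℝ :=
  (n.n₁ : ℝ) ^ 2 + (n.n₂ : ℝ) ^ 2 + (n.n₃ : ℝ) ^ 2

/-- The set `K*` of strict three-wave resonances `(k, m, n)`:
`± k₃/λ_k ± m₃/λ_m ± n₃/λ_n = 0`, `k₃ m₃ n₃ ≠ 0`, `n₃ = k₃ + m₃`, `n₂ = k₂ + m₂`. -/
def strictResonances (h R : ℝ) : Set (Mode h R × Mode h R × Mode h R) :=
  {t | ∃ k m n : Mode h R, t = (k, m, n) ∧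
    (∃ s₁ s₂ s₃ : ℤˣ,
      ((s₁ : ℤ) : ℝ) * (k.n₃ / k.lam) + ((s₂ : ℤ) : ℝ) * (m.n₃ / m.lam) +
        ((s₃ : ℤ) : ℝ) * (n.n₃ / n.lam) = 0) ∧
    k.n₃ * m.n₃ * n.n₃ ≠ 0 ∧ n.n₃ = k.n₃ + m.n₃ ∧ n.n₂ = k.n₂ + m.n₂}

end Cylinder

/-!
Axisymmetric modes (`n₂ = 0`) suffice. Take the radius `R` as unit of length, and let
`a = αR = 2π R / h`. An axisymmetric field with axial wave number `n₃ ≠ 0` is a curl eigenfunction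
exactly when its eigenvalue is `± √(4s + (a n₃)²)` with `s` a zero of
`s ↦ ∑ (-1)ᵏ sᵏ / (k! (k+1)!)`, i.e. when `2√s` is a positive zero of the Bessel function `J₁`.

* Every such zero gives modes of both polarities, by an explicit eigenfield
  (`Cylinder.isCurlEigenvalue_of_besselEntire_eq_zero`).
* Conversely the zeros are necessary (`Cylinder.besselEntire_eq_zero_of_isCurlEigenvalue`): on a
  ray, the axial and azimuthal components solve a first-order system, singular on the axis, whose
  bounded solutions are determined by the axial component at `r = 0`. As the zeros are isolated,
  finitely many eigenvalues lie below any bound, so each eigenvalue has an index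
  (`Cylinder.exists_isNthCurlEigenvalue`).
* The zeros are unbounded (`Cylinder.exists_besselEntire_one_eq_zero`).

For the triad, take `k₃ = (l + 1) M`, `m₃ = -M`, `n₃ = l M`, polarities `+, +, -`, one radial zero
`t` for both `k` and `n`, and a zero `s` much smaller than `t` for `m`. The resonance relation is
then `k₃/|λ_k| + n₃/|λ_n| = M/|λ_m|`. As `a → 0` the right side dominates, as `a → ∞` the left
side does, so some `a` solves it (`Cylinder.exists_resonant_axial_unit`). The relation gives
`|λ_m|/λ_k ≤ M/k₃ = 1/(l+1)`, and the common radial zero gives `l/(l+1) ≤ |λ_n|/λ_k ≤ 1`; large `l`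
separates the scales, and large `M` makes all of them small.
-/

namespace Cylinder

/-! ### Entire functions associated with the Bessel functions -/

/-- The entire function `∑ (-1)ᵏ sᵏ / (k! (k+n)!)` of the real variable `s`, so that
`Jₙ(x) = (x/2)ⁿ besselEntire n (x²/4)` for the Bessel function `Jₙ`. -/
noncomputable def besselEntire (n : ℕ) (s : ℝ) : ℝ :=
  ∑' k : ℕ, (-1) ^ k / (k.factorial * (k + n).factorial : ℝ) * s ^ k

theorem summable_besselEntire (n : ℕ) (s : ℝ) :
    Summable fun k : ℕ => (-1) ^ k / (k.factorial * (k + n).factorial : ℝ) * s ^ k := by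
  refine Summable.of_norm_bounded (Real.summable_pow_div_factorial |s|) fun k => ?_
  have h1 : (1 : ℝ) ≤ (k + n).factorial := by exact_mod_cast Nat.succ_le_of_lt (Nat.factorial_pos _)
  have h2 : (0 : ℝ) < k.factorial := by exact_mod_cast Nat.factorial_pos _
  rw [norm_mul, norm_div, norm_pow, norm_pow, norm_neg, norm_one, one_pow, Real.norm_eq_abs,
    Real.norm_eq_abs, abs_of_pos (by positivity), div_mul_eq_mul_div, one_mul]
  exact div_le_div_of_nonneg_left (by positivity) h2 (le_mul_of_one_le_right h2.le h1)

theorem besselEntire_zero_pos (n : ℕ) : 0 < besselEntire n 0 := by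
  have : besselEntire n 0 = 1 / (n.factorial : ℝ) := by
    rw [besselEntire, tsum_eq_single 0]
    · simp
    · intro k hk
      simp [hk]
  rw [this]
  positivity

theorem hasDerivAt_besselEntire (n : ℕ) (s : ℝ) :
    HasDerivAt (besselEntire n) (-besselEntire (n + 1) s) s := by
  set r : ℝ := |s| + 1 with hr
  have hr1 : 1 ≤ r := by linarith [abs_nonneg s]
  have key : HasDerivAt (besselEntire n)
      (∑' k : ℕ, (-1) ^ k / (k.factorial * (k + n).factorial : ℝ) * (k * s ^ (k - 1))) s := by
    refine hasDerivAt_tsum_of_isPreconnected (Real.summable_pow_div_factorial r)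
      (Metric.isOpen_ball (x := (0 : ℝ)) (ε := r)) (convex_ball _ _).isPreconnected
      (fun k y _ => (hasDerivAt_pow k y).const_mul _) (fun k y hy => ?_)
      (y₀ := 0) (by simp; linarith) (summable_besselEntire n 0) (by simp [hr])
    have hy' : |y| ≤ r := by simpa using (Metric.mem_ball.1 hy).le
    have h2 : (0 : ℝ) < k.factorial := by exact_mod_cast Nat.factorial_pos _
    have h3 : (0 : ℝ) < (k + n).factorial := by exact_mod_cast Nat.factorial_pos _
    have h4 : (k : ℝ) ≤ (k + n).factorial := by
      exact_mod_cast (Nat.le_add_right k n).trans (Nat.self_le_factorial _)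
    rw [norm_mul, norm_div, norm_pow (-1 : ℝ), norm_neg, norm_one, one_pow,
      Real.norm_of_nonneg (mul_pos h2 h3).le, norm_mul, norm_pow, Real.norm_natCast,
      Real.norm_eq_abs]
    have h5 : |y| ^ (k - 1) ≤ r ^ k :=
      (pow_le_pow_left₀ (abs_nonneg y) hy' _).trans (pow_le_pow_right₀ hr1 (Nat.sub_le _ _))
    calc 1 / ((k.factorial : ℝ) * (k + n).factorial) * (k * |y| ^ (k - 1))
        ≤ 1 / ((k.factorial : ℝ) * (k + n).factorial) * ((k + n).factorial * r ^ k) := by gcongr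
      _ = r ^ k / k.factorial := by field_simp
  have hsum : Summable fun k : ℕ =>
      (-1) ^ k / (k.factorial * (k + n).factorial : ℝ) * (k * s ^ (k - 1)) := by
    rw [← summable_nat_add_iff 1]
    refine (summable_besselEntire (n + 1) s).neg.congr fun k => ?_
    rw [Nat.factorial_succ, show k + 1 + n = k + (n + 1) by ring, Nat.add_sub_cancel]
    push_cast
    field_simp
    ring
  convert key using 1
  rw [hsum.tsum_eq_zero_add, besselEntire, ← tsum_neg]
  simp only [Nat.cast_zero, zero_mul, mul_zero, zero_add]
  refine tsum_congr fun k => ?_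
  rw [Nat.factorial_succ, show k + 1 + n = k + (n + 1) by ring, Nat.add_sub_cancel]
  push_cast
  field_simp
  ring

theorem continuous_besselEntire (n : ℕ) : Continuous (besselEntire n) :=
  continuous_iff_continuousAt.2 fun s => (hasDerivAt_besselEntire n s).continuousAt

theorem contDiff_besselEntire (n : ℕ) : ContDiff ℝ ∞ (besselEntire n) := by
  refine contDiff_infty.2 fun m => ?_
  induction m generalizing n with
  | zero => exact contDiff_zero.2 (continuous_besselEntire n)
  | succ m ih =>
    rw [Nat.cast_add, Nat.cast_one, contDiff_succ_iff_deriv]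
    refine ⟨fun s => (hasDerivAt_besselEntire n s).differentiableAt, by simp, ?_⟩
    rw [show deriv (besselEntire n) = fun s => -besselEntire (n + 1) s from
      funext fun s => (hasDerivAt_besselEntire n s).deriv]
    exact (ih (n + 1)).neg

theorem analyticOnNhd_besselEntire (n : ℕ) : AnalyticOnNhd ℝ (besselEntire n) Set.univ := by
  set c : ℕ → ℝ := fun k => (-1) ^ k / (k.factorial * (k + n).factorial : ℝ) with hc
  have hrad : (FormalMultilinearSeries.ofScalars ℝ c).radius = ⊤ := by
    refine FormalMultilinearSeries.radius_eq_top_of_summable_norm _ fun r => ?_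
    refine (summable_besselEntire n r).norm.congr fun k => ?_
    rw [FormalMultilinearSeries.ofScalars_norm, norm_mul, norm_pow,
      Real.norm_of_nonneg r.coe_nonneg]
  have hsum : (FormalMultilinearSeries.ofScalars ℝ c).sum = besselEntire n := by
    change FormalMultilinearSeries.ofScalarsSum c = _
    rw [FormalMultilinearSeries.ofScalarsSum_eq_tsum]
    rfl
  have h := (FormalMultilinearSeries.ofScalars ℝ c).hasFPowerSeriesOnBall (by simp [hrad])
  rw [hsum, hrad] at h
  simpa using h.analyticOnNhd

theorem besselEntire_zero_eq (s : ℝ) :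
    besselEntire 0 s = besselEntire 1 s - s * besselEntire 2 s := by
  have hs : Summable fun k : ℕ =>
      (-1) ^ k / (k.factorial * (k + 1).factorial : ℝ) * (k * s ^ k) := by
    rw [← summable_nat_add_iff 1]
    refine ((summable_besselEntire 2 s).mul_left (-s)).congr fun k => ?_
    rw [Nat.factorial_succ k, show k + 1 + 1 = k + 2 by ring]
    push_cast
    field_simp
    ring
  have h2 : s * besselEntire 2 s =
      -∑' k : ℕ, (-1) ^ k / (k.factorial * (k + 1).factorial : ℝ) * (k * s ^ k) := by
    rw [hs.tsum_eq_zero_add, besselEntire, ← tsum_mul_left]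
    simp only [Nat.cast_zero, zero_mul, mul_zero, zero_add]
    rw [← tsum_neg]
    refine tsum_congr fun k => ?_
    rw [Nat.factorial_succ k, show k + 1 + 1 = k + 2 by ring]
    push_cast
    field_simp
    ring
  rw [h2, sub_neg_eq_add, besselEntire, besselEntire, ← (summable_besselEntire 1 s).tsum_add hs]
  refine tsum_congr fun k => ?_
  rw [Nat.factorial_succ k, add_zero]
  push_cast
  field_simp
  ring

/-! ### Unboundedness of the zeros of `J₁` -/

/-- Oscillation criterion: a solution of `(s f')' = -f` cannot stay positive near `+∞`.
If the decreasing function `g = s f'` becomes negative, then `f` falls below a negative multiple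
of `log`; otherwise `f` is bounded below by a positive constant, and then `g` tends to `-∞`. -/
theorem not_forall_pos_of_oscillatory {f g : ℝ → ℝ} {T : ℝ} (hT : 0 < T)
    (hf : ∀ s ≥ T, HasDerivAt f (g s / s) s) (hg : ∀ s ≥ T, HasDerivAt g (-f s) s) :
    ¬ ∀ s ≥ T, 0 < f s := by
  intro hpos
  have hgc : ContinuousOn g (Set.Ici T) := fun s hs => (hg s hs).continuousAt.continuousWithinAt
  have hfc : ContinuousOn f (Set.Ici T) := fun s hs => (hf s hs).continuousAt.continuousWithinAt
  have hganti : AntitoneOn g (Set.Ici T) := by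
    refine antitoneOn_of_deriv_nonpos (convex_Ici T) hgc
      (fun s hs => (hg s (interior_subset hs)).differentiableAt.differentiableWithinAt)
      fun s hs => ?_
    rw [(hg s (interior_subset hs)).deriv]
    linarith [hpos s (interior_subset hs)]
  by_cases hneg : ∃ a ≥ T, g a < 0
  · obtain ⟨a, haT, ha⟩ := hneg
    have ha0 : 0 < a := hT.trans_le haT
    have hanti : AntitoneOn (fun s => f s - g a * Real.log s) (Set.Ici a) := by
      have hd : ∀ s ≥ a, HasDerivAt (fun s => f s - g a * Real.log s) (g s / s - g a * s⁻¹) s :=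
        fun s hs => (hf s (haT.trans hs)).sub
          ((Real.hasDerivAt_log (ha0.trans_le hs).ne').const_mul _)
      refine antitoneOn_of_deriv_nonpos (convex_Ici a)
        (fun s hs => (hd s hs).continuousAt.continuousWithinAt)
        (fun s hs => (hd s (interior_subset hs)).differentiableAt.differentiableWithinAt)
        fun s hs => ?_
      have hs' : a ≤ s := interior_subset hs
      rw [(hd s hs').deriv, div_eq_mul_inv, ← sub_mul]
      exact mul_nonpos_of_nonpos_of_nonneg
        (sub_nonpos.2 (hganti haT (haT.trans hs') hs')) (inv_nonneg.2 (ha0.le.trans hs'))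
    have hlim : Filter.Tendsto (fun s => f a - g a * Real.log a + g a * Real.log s)
        Filter.atTop Filter.atBot :=
      Filter.tendsto_atBot_add_const_left _ _ (Real.tendsto_log_atTop.const_mul_atTop_of_neg ha)
    obtain ⟨s, hs0, hsa⟩ := ((hlim.eventually (Filter.eventually_le_atBot 0)).and
      (Filter.eventually_ge_atTop a)).exists
    have h1 : f s - g a * Real.log s ≤ f a - g a * Real.log a :=
      hanti (Set.mem_Ici.2 le_rfl) hsa hsa
    linarith [hpos s (haT.trans hsa)]
  · push Not at hneg
    have hmono : MonotoneOn f (Set.Ici T) := by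
      refine monotoneOn_of_deriv_nonneg (convex_Ici T) hfc
        (fun s hs => (hf s (interior_subset hs)).differentiableAt.differentiableWithinAt)
        fun s hs => ?_
      have hs' : T ≤ s := interior_subset hs
      rw [(hf s hs').deriv]
      exact div_nonneg (hneg s hs') (hT.le.trans hs')
    have hanti : AntitoneOn (fun s => g s + f T * s) (Set.Ici T) := by
      have hd : ∀ s ≥ T, HasDerivAt (fun s => g s + f T * s) (-f s + f T * 1) s :=
        fun s hs => (hg s hs).add ((hasDerivAt_id s).const_mul _)
      refine antitoneOn_of_deriv_nonpos (convex_Ici T)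
        (fun s hs => (hd s hs).continuousAt.continuousWithinAt)
        (fun s hs => (hd s (interior_subset hs)).differentiableAt.differentiableWithinAt)
        fun s hs => ?_
      have hs' : T ≤ s := interior_subset hs
      rw [(hd s hs').deriv]
      linarith [hmono (Set.mem_Ici.2 le_rfl) hs' hs']
    have hfT := hpos T le_rfl
    set s := T + (g T + 1) / f T with hs
    have hgT := hneg T le_rfl
    have hsT : T ≤ s := by rw [hs]; linarith [div_nonneg (by linarith : 0 ≤ g T + 1) hfT.le]
    have h1 : g s + f T * s ≤ g T + f T * T := hanti (Set.mem_Ici.2 le_rfl) hsT hsT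
    have h2 : f T * s = f T * T + (g T + 1) := by rw [hs]; field_simp
    linarith [hneg s hsT]

theorem hasDerivAt_mul_besselEntire_one (s : ℝ) :
    HasDerivAt (fun s => s * besselEntire 1 s) (besselEntire 0 s) s := by
  refine ((hasDerivAt_id s).fun_mul (hasDerivAt_besselEntire 1 s)).congr_deriv ?_
  rw [besselEntire_zero_eq, id]
  ring

theorem exists_besselEntire_zero_eq_zero {T : ℝ} (hT : 0 < T) :
    ∃ s ≥ T, besselEntire 0 s = 0 := by
  by_contra! hne
  have hf : ∀ s ≥ T, HasDerivAt (besselEntire 0) (-(s * besselEntire 1 s) / s) s := by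
    intro s hs
    have : s ≠ 0 := (hT.trans_le hs).ne'
    refine (hasDerivAt_besselEntire 0 s).congr_deriv ?_
    field_simp
  have hsign : (∀ s ≥ T, 0 < besselEntire 0 s) ∨ ∀ s ≥ T, besselEntire 0 s < 0 := by
    have hpc : IsPreconnected (Set.Ici T) := isPreconnected_Ici
    rcases lt_or_gt_of_ne (hne T le_rfl) with h | h
    · right
      intro s hs
      by_contra! h'
      obtain ⟨x, hx, hx0⟩ := hpc.intermediate_value (Set.mem_Ici.2 le_rfl) (Set.mem_Ici.2 hs)
        (continuous_besselEntire 0).continuousOn ⟨h.le, h'⟩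
      exact hne x hx hx0
    · left
      intro s hs
      by_contra! h'
      obtain ⟨x, hx, hx0⟩ := hpc.intermediate_value (Set.mem_Ici.2 hs) (Set.mem_Ici.2 le_rfl)
        (continuous_besselEntire 0).continuousOn ⟨h', h.le⟩
      exact hne x hx hx0
  rcases hsign with h | h
  · exact not_forall_pos_of_oscillatory hT hf
      (fun s _ => (hasDerivAt_mul_besselEntire_one s).neg) h
  · refine not_forall_pos_of_oscillatory (f := fun s => -besselEntire 0 s)
      (g := fun s => s * besselEntire 1 s) hT (fun s hs => ?_)
      (fun s _ => by simpa using hasDerivAt_mul_besselEntire_one s)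
      (fun s hs => neg_pos.2 (h s hs))
    exact (hf s hs).fun_neg.congr_deriv (by ring)

/-- The positive zeros of `J₁` are unbounded. -/
theorem exists_besselEntire_one_eq_zero (T : ℝ) : ∃ s > T, besselEntire 1 s = 0 := by
  obtain ⟨a, ha, ha0⟩ := exists_besselEntire_zero_eq_zero (T := |T| + 1) (by positivity)
  obtain ⟨b, hb, hb0⟩ := exists_besselEntire_zero_eq_zero (T := a + 1)
    (by linarith [abs_nonneg T])
  obtain ⟨s, hs, hs0⟩ := exists_hasDerivAt_eq_zero (by linarith : a < b)
    (continuous_besselEntire 0).continuousOn (ha0.trans hb0.symm)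
    (fun s _ => hasDerivAt_besselEntire 0 s)
  exact ⟨s, by linarith [hs.1, le_abs_self T], by simpa using hs0⟩

/-! ### Axisymmetric curl eigenfields -/

theorem partialDeriv_eq_of_hasDerivAt {U : Field} {i j : Fin 3} {x : Point} {d : ℂ}
    (hU : DifferentiableAt ℝ (fun y => U y i) x)
    (hd : HasDerivAt (fun t : ℝ => U (Function.update x j t) i) d (x j)) :
    partialDeriv U i j x = d := by
  have hx : HasFDerivAt (fun y => U y i) (fderiv ℝ (fun y => U y i) x)
      (Function.update x j (x j)) := by
    rw [Function.update_eq_self]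
    exact hU.hasFDerivAt
  exact (hx.comp_hasDerivAt (x j) (hasDerivAt_update x j (x j))).unique hd

/-- The axial phase `exp (i γ z)`. -/
noncomputable def axialPhase (γ z : ℝ) : ℂ := Complex.exp (Complex.I * ((γ * z : ℝ) : ℂ))

/-- The radial function `besselEntire n (κ² r² / 4)` at `r² = a² + b²`, with `c` in the role
of `κ²`. -/
noncomputable def radialBessel (n : ℕ) (c a b : ℝ) : ℂ :=
  (besselEntire n (c * (a ^ 2 + b ^ 2) / 4) : ℂ)

theorem hasDerivAt_axialPhase (γ z : ℝ) :
    HasDerivAt (axialPhase γ) (Complex.I * γ * axialPhase γ z) z := by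
  have h := ((((hasDerivAt_id z).const_mul γ).ofReal_comp).const_mul Complex.I).cexp
  refine h.congr_deriv ?_
  simp only [axialPhase, id]
  push_cast
  ring

theorem hasDerivAt_radialBessel_left (n : ℕ) (c a b : ℝ) :
    HasDerivAt (fun t => radialBessel n c t b) (-(c * a / 2) * radialBessel (n + 1) c a b) a := by
  have h1 : HasDerivAt (fun t : ℝ => c * (t ^ 2 + b ^ 2) / 4) (c * a / 2) a := by
    refine ((((hasDerivAt_pow 2 a).add_const (b ^ 2)).const_mul c).div_const 4).congr_deriv ?_
    norm_num
    ring
  refine ((hasDerivAt_besselEntire n _).comp a h1).ofReal_comp.congr_deriv ?_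
  simp only [radialBessel]
  push_cast
  ring

theorem radialBessel_comm (n : ℕ) (c a b : ℝ) : radialBessel n c a b = radialBessel n c b a := by
  rw [radialBessel, radialBessel, add_comm]

theorem hasDerivAt_radialBessel_right (n : ℕ) (c a b : ℝ) :
    HasDerivAt (fun t => radialBessel n c a t) (-(c * b / 2) * radialBessel (n + 1) c a b) b := by
  simp only [radialBessel_comm n c a, radialBessel_comm (n + 1) c a]
  exact hasDerivAt_radialBessel_left n c b a

/-- The axisymmetric curl eigenfield with eigenvalue `lam` and axial frequency `γ`:
in cylindrical components and with `κ² = lam² - γ²`, it is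
`(-iγ/κ J₁(κr), lam/κ J₁(κr), J₀(κr)) exp(iγz)`. Written through `besselEntire` it is smooth on
the axis, and no division by `κ` is needed. -/
noncomputable def axisymField (lam γ : ℝ) : Field := fun x =>
  ![axialPhase γ (x 2) * ((-(Complex.I * γ / 2) * x 0 - lam / 2 * x 1) *
      radialBessel 1 (lam ^ 2 - γ ^ 2) (x 0) (x 1)),
    axialPhase γ (x 2) * ((-(Complex.I * γ / 2) * x 1 + lam / 2 * x 0) *
      radialBessel 1 (lam ^ 2 - γ ^ 2) (x 0) (x 1)),
    axialPhase γ (x 2) * radialBessel 0 (lam ^ 2 - γ ^ 2) (x 0) (x 1)]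

theorem contDiff_axisymField (lam γ : ℝ) : ContDiff ℝ ∞ (axisymField lam γ) := by
  have hco : ∀ i : Fin 3, ContDiff ℝ ∞ fun x : Point => x i := fun i => contDiff_apply ℝ ℝ i
  have hc : ∀ i : Fin 3, ContDiff ℝ ∞ fun x : Point => ((x i : ℝ) : ℂ) := fun i =>
    Complex.ofRealCLM.contDiff.comp (hco i)
  have hE : ContDiff ℝ ∞ fun x : Point => axialPhase γ (x 2) :=
    (contDiff_const.mul (Complex.ofRealCLM.contDiff.comp (contDiff_const.mul (hco 2)))).cexp
  have hB : ∀ n, ContDiff ℝ ∞ fun x : Point => radialBessel n (lam ^ 2 - γ ^ 2) (x 0) (x 1) :=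
    fun n => Complex.ofRealCLM.contDiff.comp ((contDiff_besselEntire n).comp
      ((contDiff_const.mul (((hco 0).pow 2).add ((hco 1).pow 2))).div_const 4))
  refine contDiff_pi.2 fun i => ?_
  fin_cases i
  · exact hE.mul (((contDiff_const.mul (hc 0)).sub (contDiff_const.mul (hc 1))).mul (hB 1))
  · exact hE.mul (((contDiff_const.mul (hc 1)).add (contDiff_const.mul (hc 0))).mul (hB 1))
  · exact hE.mul (hB 0)

section Derivatives

variable (lam γ : ℝ) (x : Point)

theorem differentiableAt_axisymField (i : Fin 3) :
    DifferentiableAt ℝ (fun y => axisymField lam γ y i) x :=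
  (contDiff_pi.1 (contDiff_axisymField lam γ) i).differentiable (by simp) x

theorem hasDerivAt_ofReal (t : ℝ) : HasDerivAt (fun t : ℝ => (t : ℂ)) 1 t :=
  Complex.ofRealCLM.hasDerivAt

theorem partialDeriv_axisymField_zero_zero : partialDeriv (axisymField lam γ) 0 0 x =
    axialPhase γ (x 2) * (-(Complex.I * γ / 2) * radialBessel 1 (lam ^ 2 - γ ^ 2) (x 0) (x 1) +
      (-(Complex.I * γ / 2) * x 0 - lam / 2 * x 1) * (-((lam ^ 2 - γ ^ 2 : ℝ) * x 0 / 2) *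
        radialBessel 2 (lam ^ 2 - γ ^ 2) (x 0) (x 1))) := by
  refine partialDeriv_eq_of_hasDerivAt (differentiableAt_axisymField lam γ x 0) ?_
  simp only [axisymField, Matrix.cons_val, Function.update_self, ne_eq, Fin.reduceEq,
    not_false_eq_true, Function.update_of_ne]
  refine ((((((hasDerivAt_ofReal (x 0)).const_mul _).sub_const _).fun_mul
    (hasDerivAt_radialBessel_left 1 _ (x 0) (x 1))).const_mul _)).congr_deriv ?_
  ring

theorem partialDeriv_axisymField_zero_one : partialDeriv (axisymField lam γ) 0 1 x =
    axialPhase γ (x 2) * (-(lam / 2) * radialBessel 1 (lam ^ 2 - γ ^ 2) (x 0) (x 1) +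
      (-(Complex.I * γ / 2) * x 0 - lam / 2 * x 1) * (-((lam ^ 2 - γ ^ 2 : ℝ) * x 1 / 2) *
        radialBessel 2 (lam ^ 2 - γ ^ 2) (x 0) (x 1))) := by
  refine partialDeriv_eq_of_hasDerivAt (differentiableAt_axisymField lam γ x 0) ?_
  simp only [axisymField, Matrix.cons_val, Function.update_self, ne_eq, Fin.reduceEq,
    not_false_eq_true, Function.update_of_ne]
  refine ((((((hasDerivAt_ofReal (x 1)).const_mul _).const_sub _).fun_mul
    (hasDerivAt_radialBessel_right 1 _ (x 0) (x 1))).const_mul _)).congr_deriv ?_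
  ring

theorem partialDeriv_axisymField_one_zero : partialDeriv (axisymField lam γ) 1 0 x =
    axialPhase γ (x 2) * (lam / 2 * radialBessel 1 (lam ^ 2 - γ ^ 2) (x 0) (x 1) +
      (-(Complex.I * γ / 2) * x 1 + lam / 2 * x 0) * (-((lam ^ 2 - γ ^ 2 : ℝ) * x 0 / 2) *
        radialBessel 2 (lam ^ 2 - γ ^ 2) (x 0) (x 1))) := by
  refine partialDeriv_eq_of_hasDerivAt (differentiableAt_axisymField lam γ x 1) ?_
  simp only [axisymField, Matrix.cons_val, Function.update_self, ne_eq, Fin.reduceEq,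
    not_false_eq_true, Function.update_of_ne]
  refine ((((((hasDerivAt_ofReal (x 0)).const_mul _).const_add _).fun_mul
    (hasDerivAt_radialBessel_left 1 _ (x 0) (x 1))).const_mul _)).congr_deriv ?_
  ring

theorem partialDeriv_axisymField_one_one : partialDeriv (axisymField lam γ) 1 1 x =
    axialPhase γ (x 2) * (-(Complex.I * γ / 2) * radialBessel 1 (lam ^ 2 - γ ^ 2) (x 0) (x 1) +
      (-(Complex.I * γ / 2) * x 1 + lam / 2 * x 0) * (-((lam ^ 2 - γ ^ 2 : ℝ) * x 1 / 2) *
        radialBessel 2 (lam ^ 2 - γ ^ 2) (x 0) (x 1))) := by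
  refine partialDeriv_eq_of_hasDerivAt (differentiableAt_axisymField lam γ x 1) ?_
  simp only [axisymField, Matrix.cons_val, Function.update_self, ne_eq, Fin.reduceEq,
    not_false_eq_true, Function.update_of_ne]
  refine ((((((hasDerivAt_ofReal (x 1)).const_mul _).add_const _).fun_mul
    (hasDerivAt_radialBessel_right 1 _ (x 0) (x 1))).const_mul _)).congr_deriv ?_
  ring

theorem partialDeriv_axisymField_two_zero : partialDeriv (axisymField lam γ) 2 0 x =
    axialPhase γ (x 2) * (-((lam ^ 2 - γ ^ 2 : ℝ) * x 0 / 2) *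
        radialBessel 1 (lam ^ 2 - γ ^ 2) (x 0) (x 1)) := by
  refine partialDeriv_eq_of_hasDerivAt (differentiableAt_axisymField lam γ x 2) ?_
  simp only [axisymField, Matrix.cons_val, Function.update_self, ne_eq, Fin.reduceEq,
    not_false_eq_true, Function.update_of_ne]
  exact (hasDerivAt_radialBessel_left 0 _ (x 0) (x 1)).const_mul _

theorem partialDeriv_axisymField_two_one : partialDeriv (axisymField lam γ) 2 1 x =
    axialPhase γ (x 2) * (-((lam ^ 2 - γ ^ 2 : ℝ) * x 1 / 2) *
        radialBessel 1 (lam ^ 2 - γ ^ 2) (x 0) (x 1)) := by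
  refine partialDeriv_eq_of_hasDerivAt (differentiableAt_axisymField lam γ x 2) ?_
  simp only [axisymField, Matrix.cons_val, Function.update_self, ne_eq, Fin.reduceEq,
    not_false_eq_true, Function.update_of_ne]
  exact (hasDerivAt_radialBessel_right 0 _ (x 0) (x 1)).const_mul _

theorem partialDeriv_axisymField_axial (i : Fin 3) : partialDeriv (axisymField lam γ) i 2 x =
    Complex.I * γ * axisymField lam γ x i := by
  refine partialDeriv_eq_of_hasDerivAt (differentiableAt_axisymField lam γ x i) ?_
  fin_cases i <;>
  · simp only [axisymField, Matrix.cons_val, Function.update_self, ne_eq, Fin.reduceEq,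
      not_false_eq_true, Function.update_of_ne, Fin.zero_eta, Fin.mk_one, Fin.reduceFinMk,
      Fin.isValue]
    exact ((hasDerivAt_axialPhase γ (x 2)).mul_const _).congr_deriv (by ring)

theorem radialBessel_zero_eq (c a b : ℝ) : radialBessel 0 c a b =
    radialBessel 1 c a b - c * (a ^ 2 + b ^ 2) / 4 * radialBessel 2 c a b := by
  simp only [radialBessel, besselEntire_zero_eq]
  push_cast
  ring

theorem divergence_axisymField : divergence (axisymField lam γ) x = 0 := by
  rw [divergence, partialDeriv_axisymField_zero_zero, partialDeriv_axisymField_one_one,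
    partialDeriv_axisymField_axial]
  simp only [axisymField, Matrix.cons_val, radialBessel_zero_eq]
  push_cast
  ring

theorem curl_axisymField : curl (axisymField lam γ) x = (lam : ℂ) • axisymField lam γ x := by
  funext i
  fin_cases i
  · simp only [curl, partialDeriv_axisymField_two_one, partialDeriv_axisymField_axial,
      axisymField, Pi.smul_apply, smul_eq_mul, Matrix.cons_val, Fin.zero_eta]
    push_cast
    linear_combination (axialPhase γ (x 2) * γ ^ 2 * x 1 / 2 *
      radialBessel 1 (lam ^ 2 - γ ^ 2) (x 0) (x 1)) * Complex.I_sq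
  · simp only [curl, partialDeriv_axisymField_two_zero, partialDeriv_axisymField_axial,
      axisymField, Pi.smul_apply, smul_eq_mul, Matrix.cons_val, Fin.mk_one]
    push_cast
    linear_combination (-(axialPhase γ (x 2) * γ ^ 2 * x 0 / 2 *
      radialBessel 1 (lam ^ 2 - γ ^ 2) (x 0) (x 1))) * Complex.I_sq
  · simp only [curl, partialDeriv_axisymField_one_zero, partialDeriv_axisymField_zero_one,
      axisymField, Pi.smul_apply, smul_eq_mul, Matrix.cons_val, Fin.reduceFinMk,
      radialBessel_zero_eq]
    push_cast
    ring

end Derivatives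

theorem rotation_mulVec_add (θ z : ℝ) (x : Point) :
    (rotation θ).mulVec x + z • Pi.single 2 1 =
      ![Real.cos θ * x 0 + -Real.sin θ * x 1, Real.sin θ * x 0 + Real.cos θ * x 1, x 2 + z] := by
  funext i
  fin_cases i <;> simp [rotation, dotProduct, Fin.sum_univ_three]

theorem axisymField_equivariant (lam γ θ z : ℝ) (x : Point) :
    axisymField lam γ ((rotation θ).mulVec x + z • Pi.single 2 1) =
      Complex.exp (Complex.I * ((γ * z : ℝ) : ℂ)) •
        ((rotation θ).map Complex.ofReal).mulVec (axisymField lam γ x) := by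
  have hr : ∀ n, radialBessel n (lam ^ 2 - γ ^ 2) (Real.cos θ * x 0 + -Real.sin θ * x 1)
      (Real.sin θ * x 0 + Real.cos θ * x 1) =
      radialBessel n (lam ^ 2 - γ ^ 2) (x 0) (x 1) := fun n => by
    rw [radialBessel, radialBessel]
    congr 4
    linear_combination (x 0 ^ 2 + x 1 ^ 2) * Real.sin_sq_add_cos_sq θ
  have he : axialPhase γ (x 2 + z) =
      Complex.exp (Complex.I * ((γ * z : ℝ) : ℂ)) * axialPhase γ (x 2) := by
    rw [axialPhase, axialPhase, ← Complex.exp_add]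
    congr 1
    push_cast
    ring
  funext i
  fin_cases i <;>
  · simp only [axisymField, rotation_mulVec_add, Matrix.cons_val, hr, he]
    simp [rotation, Matrix.mulVec, dotProduct, Fin.sum_univ_three]
    try ring

/-- At a zero of `J₁` the axisymmetric field is tangent to the lateral boundary, hence it is
an eigenfunction. -/
theorem isCurlEigenvalue_of_besselEntire_eq_zero {h R lam : ℝ} {n₃ : ℤ} (hR : 0 < R)
    (hlam : lam ≠ 0)
    (hz : besselEntire 1 ((lam ^ 2 - (axialUnit h * n₃) ^ 2) * R ^ 2 / 4) = 0) :
    IsCurlEigenvalue h R 0 n₃ lam := by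
  refine ⟨hlam, axisymField lam (axialUnit h * n₃), ?_⟩
  constructor
  · exact (contDiff_axisymField _ _).contDiffOn
  · exact (contDiff_axisymField _ _).continuous.continuousOn
  · exact fun x _ => divergence_axisymField _ _ x
  · exact fun x _ => curl_axisymField _ _ x
  · intro x hx
    have hx' : x 0 ^ 2 + x 1 ^ 2 = R ^ 2 := hx
    simp [axisymField, radialBessel, hx', hz]
  · intro θ z x _
    simpa using axisymField_equivariant lam (axialUnit h * n₃) θ z x
  · refine ⟨0, by simpa [openCyl] using pow_pos hR 2, fun h0 => ?_⟩
    have := congrFun h0 2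
    simp [axisymField, radialBessel, axialPhase, (besselEntire_zero_pos 0).ne'] at this

/-! ### The dispersion relation -/

/-- Uniqueness for the singular system `q' = lam w - q/r`, `w' = -c q` from `r = 0`: the singular
term `-q/r` only decreases the energy `q² + w²`, which therefore satisfies a Gronwall
inequality. -/
theorem eq_zero_of_radial_system_real {R lam c : ℝ} {q w : ℝ → ℝ}
    (hqc : ContinuousOn q (Set.Icc 0 R)) (hwc : ContinuousOn w (Set.Icc 0 R))
    (hq : ∀ r ∈ Set.Ioo 0 R, HasDerivAt q (lam * w r - q r / r) r)
    (hw : ∀ r ∈ Set.Ioo 0 R, HasDerivAt w (-(c * q r)) r) (hq0 : q 0 = 0) (hw0 : w 0 = 0)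
    {r : ℝ} (hr : r ∈ Set.Icc 0 R) : q r = 0 ∧ w r = 0 := by
  set C : ℝ := |lam - c|
  have hanti : AntitoneOn (fun r => (q r ^ 2 + w r ^ 2) * Real.exp (-C * r)) (Set.Icc 0 R) := by
    have hd : ∀ r ∈ Set.Ioo 0 R, HasDerivAt (fun r => (q r ^ 2 + w r ^ 2) * Real.exp (-C * r))
        ((2 * q r * (lam * w r - q r / r) + 2 * w r * (-(c * q r))
          - C * (q r ^ 2 + w r ^ 2)) * Real.exp (-C * r)) r := fun r hr => by
      refine ((((hq r hr).fun_pow 2).fun_add ((hw r hr).fun_pow 2)).fun_mul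
        ((hasDerivAt_id r).const_mul (-C)).exp).congr_deriv ?_
      simp only [id]
      norm_num
      ring
    refine antitoneOn_of_deriv_nonpos (convex_Icc 0 R)
      (((hqc.pow 2).add (hwc.pow 2)).mul (by fun_prop)) (fun r hr => ?_) (fun r hr => ?_)
    · rw [interior_Icc] at hr
      exact (hd r hr).differentiableAt.differentiableWithinAt
    · rw [interior_Icc] at hr
      rw [(hd r hr).deriv]
      refine mul_nonpos_of_nonpos_of_nonneg ?_ (Real.exp_pos _).le
      have h1 : 0 ≤ q r * (q r / r) := by
        rw [← mul_div_assoc]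
        exact div_nonneg (mul_self_nonneg _) hr.1.le
      have h2 : (lam - c) * (2 * (q r * w r)) ≤ C * (q r ^ 2 + w r ^ 2) := by
        refine (le_abs_self _).trans ?_
        rw [abs_mul]
        refine mul_le_mul_of_nonneg_left (abs_le.2 ⟨?_, ?_⟩) (abs_nonneg _)
        · nlinarith [sq_nonneg (q r + w r)]
        · nlinarith [sq_nonneg (q r - w r)]
      linarith
  have h := hanti (Set.left_mem_Icc.2 (hr.1.trans hr.2)) hr hr.1
  have h0 : (q r ^ 2 + w r ^ 2) * Real.exp (-C * r) ≤ 0 := by simpa [hq0, hw0] using h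
  have h1 : q r ^ 2 + w r ^ 2 ≤ 0 := nonpos_of_mul_nonpos_left h0 (Real.exp_pos _)
  constructor <;> nlinarith [sq_nonneg (q r), sq_nonneg (w r)]

theorem eq_zero_of_radial_system {R lam c : ℝ} {q w : ℝ → ℂ}
    (hqc : ContinuousOn q (Set.Icc 0 R)) (hwc : ContinuousOn w (Set.Icc 0 R))
    (hq : ∀ r ∈ Set.Ioo 0 R, HasDerivAt q (lam * w r - q r / r) r)
    (hw : ∀ r ∈ Set.Ioo 0 R, HasDerivAt w (-(c * q r)) r) (hq0 : q 0 = 0) (hw0 : w 0 = 0)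
    {r : ℝ} (hr : r ∈ Set.Icc 0 R) : q r = 0 ∧ w r = 0 := by
  have hre := eq_zero_of_radial_system_real (q := fun r => (q r).re) (w := fun r => (w r).re)
    (lam := lam) (c := c) (Complex.continuous_re.comp_continuousOn hqc)
    (Complex.continuous_re.comp_continuousOn hwc)
    (fun r hr => (Complex.reCLM.hasFDerivAt.comp_hasDerivAt r (hq r hr)).congr_deriv (by simp))
    (fun r hr => (Complex.reCLM.hasFDerivAt.comp_hasDerivAt r (hw r hr)).congr_deriv (by simp))
    (by simp [hq0]) (by simp [hw0]) hr
  have him := eq_zero_of_radial_system_real (q := fun r => (q r).im) (w := fun r => (w r).im)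
    (lam := lam) (c := c) (Complex.continuous_im.comp_continuousOn hqc)
    (Complex.continuous_im.comp_continuousOn hwc)
    (fun r hr => (Complex.imCLM.hasFDerivAt.comp_hasDerivAt r (hq r hr)).congr_deriv (by simp))
    (fun r hr => (Complex.imCLM.hasFDerivAt.comp_hasDerivAt r (hw r hr)).congr_deriv (by simp))
    (by simp [hq0]) (by simp [hw0]) hr
  exact ⟨Complex.ext hre.1 him.1, Complex.ext hre.2 him.2⟩

theorem isOpen_openCyl (R : ℝ) : IsOpen (openCyl R) :=
  isOpen_lt (by fun_prop) continuous_const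

theorem openCyl_subset_closedCyl (R : ℝ) : openCyl R ⊆ closedCyl R := fun x hx =>
  le_of_lt (show x 0 ^ 2 + x 1 ^ 2 < R ^ 2 from hx)

theorem ray_mem_openCyl {R r : ℝ} (hr : r ∈ Set.Ioo 0 R) : ![r, 0, 0] ∈ openCyl R := by
  have := pow_lt_pow_left₀ hr.2 hr.1.le two_ne_zero
  simpa [openCyl] using this

theorem ray_mem_closedCyl {R r : ℝ} (hr : r ∈ Set.Icc 0 R) : ![r, 0, 0] ∈ closedCyl R := by
  have := pow_le_pow_left₀ hr.1 hr.2 2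
  simpa [closedCyl] using this

namespace IsCurlEigenfunction

variable {h R lam : ℝ} {n₃ : ℤ} {Φ : Field}

theorem axisym_apply (hΦ : IsCurlEigenfunction h R 0 n₃ lam Φ) (θ z : ℝ) {x : Point}
    (hx : x ∈ closedCyl R) :
    Φ ![Real.cos θ * x 0 + -Real.sin θ * x 1, Real.sin θ * x 0 + Real.cos θ * x 1, x 2 + z] =
      axialPhase (axialUnit h * n₃) z • ![Real.cos θ * Φ x 0 - Real.sin θ * Φ x 1,
        Real.sin θ * Φ x 0 + Real.cos θ * Φ x 1, Φ x 2] := by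
  rw [← rotation_mulVec_add, hΦ.equivariant θ z x hx, axialPhase]
  congr 1
  · simp
  · funext i
    fin_cases i <;>
      simp [rotation, dotProduct, Matrix.mulVec, Fin.sum_univ_three, sub_eq_add_neg]

theorem hasDerivAt_comp_curve (hΦ : IsCurlEigenfunction h R 0 n₃ lam Φ) {x : Point}
    (hx : x ∈ openCyl R) {γ : ℝ → Point} {t c : ℝ} {j : Fin 3}
    (hγ : HasDerivAt γ (c • Pi.single j 1) t) (hγx : γ t = x) (i : Fin 3) :
    HasDerivAt (fun s => Φ (γ s) i) (c * partialDeriv Φ i j x) t := by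
  have hd : DifferentiableAt ℝ (fun y => Φ y i) x := differentiableAt_pi.1
    ((hΦ.smooth.contDiffAt ((isOpen_openCyl R).mem_nhds hx)).differentiableAt (by simp)) i
  have h1 : HasFDerivAt (fun y => Φ y i) (fderiv ℝ (fun y => Φ y i) x) (γ t) := by
    rw [hγx]
    exact hd.hasFDerivAt
  refine (h1.comp_hasDerivAt t hγ).congr_deriv ?_
  rw [map_smul, Complex.real_smul]
  rfl

theorem hasDerivAt_ray (hΦ : IsCurlEigenfunction h R 0 n₃ lam Φ) {r : ℝ} (hr : r ∈ Set.Ioo 0 R)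
    (i : Fin 3) : HasDerivAt (fun s => Φ ![s, 0, 0] i) (partialDeriv Φ i 0 ![r, 0, 0]) r := by
  have hγ : HasDerivAt (fun s : ℝ => (![s, 0, 0] : Point)) ((1 : ℝ) • Pi.single 0 1) r := by
    refine hasDerivAt_pi.2 fun k => ?_
    fin_cases k
    · simpa using hasDerivAt_id' r
    · simpa using hasDerivAt_const r (0 : ℝ)
    · simpa using hasDerivAt_const r (0 : ℝ)
  simpa using hΦ.hasDerivAt_comp_curve (ray_mem_openCyl hr) hγ rfl i

theorem partialDeriv_axial (hΦ : IsCurlEigenfunction h R 0 n₃ lam Φ) {r : ℝ}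
    (hr : r ∈ Set.Ioo 0 R) (i : Fin 3) : partialDeriv Φ i 2 ![r, 0, 0] =
      Complex.I * ((axialUnit h * n₃ : ℝ) : ℂ) * Φ ![r, 0, 0] i := by
  have hγ : HasDerivAt (fun s : ℝ => (![r, 0, s] : Point)) ((1 : ℝ) • Pi.single 2 1) 0 := by
    refine hasDerivAt_pi.2 fun k => ?_
    fin_cases k
    · simpa using hasDerivAt_const (0 : ℝ) r
    · simpa using hasDerivAt_const (0 : ℝ) (0 : ℝ)
    · simpa using hasDerivAt_id' (0 : ℝ)
  have h1 := hΦ.hasDerivAt_comp_curve (ray_mem_openCyl hr) hγ rfl i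
  have h2 : (fun s => Φ ![r, 0, s] i) =
      fun s => axialPhase (axialUnit h * n₃) s * Φ ![r, 0, 0] i := by
    funext s
    have := congrFun (hΦ.axisym_apply 0 s
      (openCyl_subset_closedCyl R (ray_mem_openCyl hr))) i
    simp only [Real.cos_zero, Real.sin_zero, Matrix.cons_val] at this
    rw [show (![r, 0, s] : Point) = ![1 * r + -0 * 0, 0 * r + 1 * 0, 0 + s] by simp, this]
    fin_cases i <;> simp
  rw [h2] at h1
  have h3 := h1.unique ((hasDerivAt_axialPhase (axialUnit h * n₃) 0).mul_const _)
  simpa [axialPhase] using h3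

theorem partialDeriv_azimuthal (hΦ : IsCurlEigenfunction h R 0 n₃ lam Φ) {r : ℝ}
    (hr : r ∈ Set.Ioo 0 R) (i : Fin 3) : r * partialDeriv Φ i 1 ![r, 0, 0] =
      ![-Φ ![r, 0, 0] 1, Φ ![r, 0, 0] 0, 0] i := by
  have hγ : HasDerivAt (fun θ : ℝ => (![Real.cos θ * r, Real.sin θ * r, 0] : Point))
      (r • Pi.single 1 1) 0 := by
    refine hasDerivAt_pi.2 fun k => ?_
    fin_cases k
    · simpa using (Real.hasDerivAt_cos 0).mul_const r
    · simpa using (Real.hasDerivAt_sin 0).mul_const r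
    · simpa using hasDerivAt_const (0 : ℝ) (0 : ℝ)
  have h1 := hΦ.hasDerivAt_comp_curve (ray_mem_openCyl hr) hγ (by simp) i
  have h2 : (fun θ : ℝ => Φ ![Real.cos θ * r, Real.sin θ * r, 0] i) =
      fun θ : ℝ => ![Real.cos θ * Φ ![r, 0, 0] 0 - Real.sin θ * Φ ![r, 0, 0] 1,
        Real.sin θ * Φ ![r, 0, 0] 0 + Real.cos θ * Φ ![r, 0, 0] 1, Φ ![r, 0, 0] 2] i := by
    funext θ
    have := congrFun (hΦ.axisym_apply θ 0
      (openCyl_subset_closedCyl R (ray_mem_openCyl hr))) i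
    simpa [axialPhase] using this
  rw [h2] at h1
  refine h1.unique ?_
  have hcos : HasDerivAt (fun θ : ℝ => ((Real.cos θ : ℝ) : ℂ)) 0 0 := by
    simpa using (Real.hasDerivAt_cos 0).ofReal_comp
  have hsin : HasDerivAt (fun θ : ℝ => ((Real.sin θ : ℝ) : ℂ)) 1 0 := by
    simpa using (Real.hasDerivAt_sin 0).ofReal_comp
  fin_cases i
  · exact ((hcos.mul_const _).fun_sub (hsin.mul_const _)).congr_deriv (by simp)
  · exact ((hsin.mul_const _).fun_add (hcos.mul_const _)).congr_deriv (by simp)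
  · exact hasDerivAt_const _ _

theorem continuousOn_ray (hΦ : IsCurlEigenfunction h R 0 n₃ lam Φ) (i : Fin 3) :
    ContinuousOn (fun r => Φ ![r, 0, 0] i) (Set.Icc 0 R) := by
  have h1 : Continuous fun r : ℝ => (![r, 0, 0] : Point) := by fun_prop
  exact (continuous_apply i).comp_continuousOn
    (hΦ.continuousOn.comp h1.continuousOn fun r hr => ray_mem_closedCyl hr)

theorem axis_apply_eq_zero (hΦ : IsCurlEigenfunction h R 0 n₃ lam Φ) (hR : 0 ≤ R) :
    Φ ![0, 0, 0] 1 = 0 := by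
  have h1 := congrFun (hΦ.axisym_apply Real.pi 0 (ray_mem_closedCyl ⟨le_rfl, hR⟩)) 1
  have h2 : Φ ![0, 0, 0] 1 = -Φ ![0, 0, 0] 1 := by simpa [axialPhase] using h1
  exact self_eq_neg.1 h2

/-- The first component of the curl equation; it extends to the axis and to the boundary by
continuity. -/
theorem radial_eq (hΦ : IsCurlEigenfunction h R 0 n₃ lam Φ) (hR : 0 < R) {r : ℝ}
    (hr : r ∈ Set.Icc 0 R) : lam * Φ ![r, 0, 0] 0 =
      -(Complex.I * ((axialUnit h * n₃ : ℝ) : ℂ)) * Φ ![r, 0, 0] 1 := by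
  refine Set.EqOn.of_subset_closure (s := Set.Ioo 0 R) (f := fun r => lam * Φ ![r, 0, 0] 0)
    (g := fun r => -(Complex.I * ((axialUnit h * n₃ : ℝ) : ℂ)) * Φ ![r, 0, 0] 1)
    (fun s hs => ?_) (continuousOn_const.mul (hΦ.continuousOn_ray 0))
    (continuousOn_const.mul (hΦ.continuousOn_ray 1)) Set.Ioo_subset_Icc_self
    (closure_Ioo hR.ne).ge hr
  have h1 := congrFun (hΦ.curl_eq _ (ray_mem_openCyl hs)) 0
  have h2 : partialDeriv Φ 2 1 ![s, 0, 0] = 0 := by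
    have := hΦ.partialDeriv_azimuthal hs 2
    simpa [hs.1.ne'] using this
  simp only [curl, Matrix.cons_val, h2, hΦ.partialDeriv_axial hs, Pi.smul_apply,
    smul_eq_mul] at h1
  simp only
  linear_combination -h1

theorem hasDerivAt_axial (hΦ : IsCurlEigenfunction h R 0 n₃ lam Φ) (hlam : lam ≠ 0) {r : ℝ}
    (hr : r ∈ Set.Ioo 0 R) : HasDerivAt (fun r => Φ ![r, 0, 0] 2)
      (-(((lam ^ 2 - (axialUnit h * n₃) ^ 2) / lam : ℝ) * Φ ![r, 0, 0] 1)) r := by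
  refine (hΦ.hasDerivAt_ray hr 2).congr_deriv ?_
  have h1 := congrFun (hΦ.curl_eq _ (ray_mem_openCyl hr)) 1
  simp only [curl, Matrix.cons_val, hΦ.partialDeriv_axial hr, Pi.smul_apply, smul_eq_mul] at h1
  have h2 := hΦ.radial_eq (hr.1.trans hr.2) (Set.Ioo_subset_Icc_self hr)
  have hl : (lam : ℂ) ≠ 0 := by exact_mod_cast hlam
  push_cast at h1 h2 ⊢
  field_simp
  linear_combination (-(lam : ℂ)) * h1 + Complex.I * (axialUnit h * n₃ : ℂ) * h2 -
    (axialUnit h * n₃ : ℂ) ^ 2 * Φ ![r, 0, 0] 1 * Complex.I_sq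

theorem hasDerivAt_azimuthal (hΦ : IsCurlEigenfunction h R 0 n₃ lam Φ) {r : ℝ}
    (hr : r ∈ Set.Ioo 0 R) : HasDerivAt (fun r => Φ ![r, 0, 0] 1)
      (lam * Φ ![r, 0, 0] 2 - Φ ![r, 0, 0] 1 / r) r := by
  refine (hΦ.hasDerivAt_ray hr 1).congr_deriv ?_
  have h1 := congrFun (hΦ.curl_eq _ (ray_mem_openCyl hr)) 2
  simp only [curl, Matrix.cons_val, Pi.smul_apply, smul_eq_mul] at h1
  have h2 := hΦ.partialDeriv_azimuthal hr 0
  have hr0 : (r : ℂ) ≠ 0 := by exact_mod_cast hr.1.ne'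
  simp only [Matrix.cons_val] at h2
  rw [eq_sub_iff_add_eq, ← h1, ← neg_eq_iff_eq_neg.2 h2]
  field_simp
  ring

/-- An axisymmetric eigenfunction is a multiple of the Bessel field. -/
theorem eq_bessel (hΦ : IsCurlEigenfunction h R 0 n₃ lam Φ) (hlam : lam ≠ 0) {r : ℝ}
    (hr : r ∈ Set.Icc 0 R) :
    Φ ![r, 0, 0] 1 = Φ ![0, 0, 0] 2 * (lam * r / 2 *
      radialBessel 1 (lam ^ 2 - (axialUnit h * n₃) ^ 2) r 0) ∧
    Φ ![r, 0, 0] 2 = Φ ![0, 0, 0] 2 *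
      radialBessel 0 (lam ^ 2 - (axialUnit h * n₃) ^ 2) r 0 := by
  set c : ℝ := lam ^ 2 - (axialUnit h * n₃) ^ 2 with hc
  set A : ℂ := Φ ![0, 0, 0] 2 with hA
  have hl : (lam : ℂ) ≠ 0 := by exact_mod_cast hlam
  have hB := hasDerivAt_radialBessel_left
  have hQ : ∀ r : ℝ, HasDerivAt (fun r : ℝ => A * (lam * r / 2 * radialBessel 1 c r 0))
      (A * (lam / 2 * radialBessel 1 c r 0 +
        lam * r / 2 * (-(c * r / 2) * radialBessel 2 c r 0))) r := fun r =>
    (((((hasDerivAt_ofReal r).const_mul (lam : ℂ)).div_const 2).fun_mul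
      (hB 1 c r 0)).const_mul A).congr_deriv (by ring)
  have hW : ∀ r : ℝ, HasDerivAt (fun r : ℝ => A * radialBessel 0 c r 0)
      (A * (-(c * r / 2) * radialBessel 1 c r 0)) r := fun r => (hB 0 c r 0).const_mul A
  have key := eq_zero_of_radial_system (R := R) (lam := lam) (c := c / lam)
    (q := fun r => Φ ![r, 0, 0] 1 - A * (lam * r / 2 * radialBessel 1 c r 0))
    (w := fun r => Φ ![r, 0, 0] 2 - A * radialBessel 0 c r 0)
    ((hΦ.continuousOn_ray 1).sub fun r _ => (hQ r).continuousAt.continuousWithinAt)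
    ((hΦ.continuousOn_ray 2).sub fun r _ => (hW r).continuousAt.continuousWithinAt)
    (fun r hr => ((hΦ.hasDerivAt_azimuthal hr).fun_sub (hQ r)).congr_deriv ?_)
    (fun r hr => ((hΦ.hasDerivAt_axial hlam hr).fun_sub (hW r)).congr_deriv ?_) ?_ ?_ hr
  · exact ⟨sub_eq_zero.1 key.1, sub_eq_zero.1 key.2⟩
  · have hr0 : (r : ℂ) ≠ 0 := by exact_mod_cast hr.1.ne'
    rw [radialBessel_zero_eq]
    push_cast
    field_simp
    ring
  · rw [← hc]
    push_cast
    field_simp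
    ring
  · simpa using hΦ.axis_apply_eq_zero (hr.1.trans hr.2)
  · have : besselEntire 0 0 = 1 := by
      rw [besselEntire, tsum_eq_single 0] <;> simp +contextual
    simp [radialBessel, this, hA]

/-- A point of the cylinder is a rotation and axial translation of a point of the ray, so a
nontrivial axisymmetric eigenfunction does not vanish on the axis. -/
theorem axis_apply_ne_zero (hΦ : IsCurlEigenfunction h R 0 n₃ lam Φ) (hR : 0 < R)
    (hlam : lam ≠ 0) : Φ ![0, 0, 0] 2 ≠ 0 := by
  intro hA
  obtain ⟨x, hx, hx0⟩ := hΦ.nontrivial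
  apply hx0
  set ζ : ℂ := ⟨x 0, x 1⟩ with hζ
  have hn : ‖ζ‖ ^ 2 = x 0 ^ 2 + x 1 ^ 2 := by
    rw [Complex.sq_norm, Complex.normSq_apply, hζ]
    ring
  have hr : ‖ζ‖ ∈ Set.Icc 0 R := by
    refine ⟨norm_nonneg _, abs_le_of_sq_le_sq' ?_ hR.le |>.2⟩
    rw [hn]
    exact openCyl_subset_closedCyl R hx
  have hray : Φ ![‖ζ‖, 0, 0] = 0 := by
    obtain ⟨h1, h2⟩ := hΦ.eq_bessel hlam hr
    have h3 := hΦ.radial_eq hR hr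
    rw [hA, zero_mul] at h1 h2
    have hl : (lam : ℂ) ≠ 0 := by exact_mod_cast hlam
    funext i
    fin_cases i
    · simpa [h1, hl] using h3
    · exact h1
    · exact h2
  have h := hΦ.axisym_apply ζ.arg (x 2) (ray_mem_closedCyl hr)
  have hc : Real.cos ζ.arg * ‖ζ‖ = x 0 := by rw [mul_comm, Complex.norm_mul_cos_arg]
  have hs : Real.sin ζ.arg * ‖ζ‖ = x 1 := by rw [mul_comm, Complex.norm_mul_sin_arg]
  have hxx : (![x 0, x 1, x 2] : Point) = x := by
    funext i
    fin_cases i <;> rfl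
  simp only [Matrix.cons_val, hc, hs, mul_zero, add_zero, zero_add, hxx, hray] at h
  rw [h]
  funext i
  fin_cases i <;> simp

end IsCurlEigenfunction

/-- The dispersion relation of the axisymmetric modes: `κR` is a zero of `J₁`. -/
theorem besselEntire_eq_zero_of_isCurlEigenvalue {h R lam : ℝ} {n₃ : ℤ} (hR : 0 < R)
    (hγ : axialUnit h * n₃ ≠ 0) (hev : IsCurlEigenvalue h R 0 n₃ lam) :
    besselEntire 1 ((lam ^ 2 - (axialUnit h * n₃) ^ 2) * R ^ 2 / 4) = 0 := by
  obtain ⟨hlam, Φ, hΦ⟩ := hev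
  have hRR : R ∈ Set.Icc 0 R := ⟨hR.le, le_rfl⟩
  have hR0 : (R : ℂ) ≠ 0 := by exact_mod_cast hR.ne'
  have hl : (lam : ℂ) ≠ 0 := by exact_mod_cast hlam
  have hg : ((axialUnit h * n₃ : ℝ) : ℂ) ≠ 0 := by exact_mod_cast hγ
  have h0 : Φ ![R, 0, 0] 0 = 0 := by
    have := hΦ.zero_flux ![R, 0, 0] (by simp [lateral])
    simpa [hR0] using this
  have h1 : Φ ![R, 0, 0] 1 = 0 := by
    have := hΦ.radial_eq hR hRR
    rw [h0, mul_zero, eq_comm, mul_eq_zero] at this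
    exact this.resolve_left (neg_ne_zero.2 (mul_ne_zero Complex.I_ne_zero hg))
  have h2 := (hΦ.eq_bessel hlam hRR).1
  rw [h1, eq_comm, mul_eq_zero] at h2
  have h3 := h2.resolve_left (hΦ.axis_apply_ne_zero hR hlam)
  simpa [radialBessel, hR0, hl] using h3

/-- Since `J₁` has isolated zeros, only finitely many axisymmetric eigenvalues are bounded by a
given constant, so each has an index in the enumeration by modulus. -/
theorem exists_isNthCurlEigenvalue {h R lam : ℝ} {n₃ : ℤ} (hR : 0 < R)
    (hγ : axialUnit h * n₃ ≠ 0) (hev : IsCurlEigenvalue h R 0 n₃ lam) :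
    ∃ n₁ : ℕ, IsNthCurlEigenvalue h R n₁ 0 n₃ lam := by
  set γ := axialUnit h * n₃ with hγdef
  set g : ℝ → ℝ := fun μ => besselEntire 1 ((μ ^ 2 - γ ^ 2) * R ^ 2 / 4) with hg
  have hga : AnalyticOnNhd ℝ g Set.univ := fun μ _ =>
    (analyticOnNhd_besselEntire 1 _ trivial).comp (by fun_prop)
  have hgγ : g γ ≠ 0 := by simpa [hg] using (besselEntire_zero_pos 1).ne'
  have hfin : (Set.Icc (-|lam|) |lam| \ g ⁻¹' {0}ᶜ).Finite :=
    isCompact_Icc.finite_sdiff_of_mem_codiscreteWithin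
      (Filter.codiscreteWithin_mono (Set.subset_univ _) (hga.preimage_zero_mem_codiscrete hgγ))
  have hsub : {μ : ℝ | IsCurlEigenvalue h R 0 n₃ μ ∧ 0 < μ * lam ∧ |μ| ≤ |lam|} ⊆
      Set.Icc (-|lam|) |lam| \ g ⁻¹' {0}ᶜ := fun μ hμ =>
    ⟨abs_le.1 hμ.2.2, fun hne => hne (besselEntire_eq_zero_of_isCurlEigenvalue hR hγ hμ.1)⟩
  exact ⟨_, hev, ((hfin.subset hsub).cast_ncard_eq).symm⟩

/-! ### Resonant triads -/

theorem axialUnit_eq_div {h R a : ℝ} (hR : 0 < R) (ha : 0 < a) (hρ : h / R = 2 * Real.pi / a) :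
    axialUnit h = a / R := by
  have hh : h = 2 * Real.pi / a * R := by rw [← hρ, div_mul_cancel₀ _ hR.ne']
  have := Real.pi_pos
  rw [axialUnit, hh]
  field_simp

/-- Each positive zero `s = (κR/2)²` of `besselEntire 1` yields axisymmetric modes of both
polarities, of eigenvalue `± √(κ² + γ²)`; here `a` is the axial unit measured in units of
`1 / R`. -/
theorem exists_axisymmetric_mode {h R a s σ : ℝ} {n₃ : ℤ} (hR : 0 < R) (ha : 0 < a)
    (hρ : h / R = 2 * Real.pi / a) (hs : 0 < s) (hz : besselEntire 1 s = 0) (hn : n₃ ≠ 0)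
    (hσ : σ ^ 2 = 1) :
    ∃ m : Mode h R, m.n₂ = 0 ∧ m.n₃ = n₃ ∧ m.lam = σ * √(4 * s + (a * n₃) ^ 2) / R := by
  have hax := axialUnit_eq_div hR ha hρ
  have hpos : 0 < 4 * s + (a * n₃) ^ 2 := by positivity
  have hσ0 : σ ≠ 0 := by
    rintro rfl
    norm_num at hσ
  have hev : IsCurlEigenvalue h R 0 n₃ (σ * √(4 * s + (a * n₃) ^ 2) / R) := by
    refine isCurlEigenvalue_of_besselEntire_eq_zero hR
      (div_ne_zero (mul_ne_zero hσ0 (Real.sqrt_pos.2 hpos).ne') hR.ne') ?_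
    rw [hax, div_pow, mul_pow, hσ, Real.sq_sqrt hpos.le]
    convert hz using 2
    field_simp
    ring
  have hγ : axialUnit h * n₃ ≠ 0 := by
    rw [hax]
    exact mul_ne_zero (div_pos ha hR).ne' (by exact_mod_cast hn)
  obtain ⟨n₁, hn₁⟩ := exists_isNthCurlEigenvalue hR hγ hev
  exact ⟨⟨n₁, 0, n₃, _, hn, hn₁⟩, rfl, rfl, rfl⟩

/-- The resonance relation is solved by varying the axial unit `a`. In the limit `a → 0` the
middle wave dominates as soon as `t` is large compared with `s`; for large `a` each of the three
terms is close to `1 / a`, and the sum of two of them wins. -/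
theorem exists_resonant_axial_unit {s t M N K : ℝ} (hs : 0 < s) (ht : 0 < t) (hM : 0 < M)
    (hN : 1 ≤ N) (hK : 1 ≤ K) (hst : (K + N) ^ 2 * s < M ^ 2 * t) :
    ∃ a : ℝ, 0 < a ∧ K / √(4 * t + (a * K) ^ 2) + N / √(4 * t + (a * N) ^ 2) =
      M / √(4 * s + (a * M) ^ 2) := by
  set G : ℝ → ℝ := fun a => K / √(4 * t + (a * K) ^ 2) + N / √(4 * t + (a * N) ^ 2) -
    M / √(4 * s + (a * M) ^ 2) with hG
  have hpos : ∀ {u : ℝ}, 0 < u → ∀ a n : ℝ, √(4 * u + (a * n) ^ 2) ≠ 0 := fun hu a n =>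
    (Real.sqrt_pos.2 (by positivity)).ne'
  have hcont : Continuous G :=
    ((continuous_const.div (by fun_prop) fun a => hpos ht a K).add
      (continuous_const.div (by fun_prop) fun a => hpos ht a N)).sub
      (continuous_const.div (by fun_prop) fun a => hpos hs a M)
  have h0 : G 0 < 0 := by
    have hs4 : 0 < √(4 * s) := Real.sqrt_pos.2 (by positivity)
    have ht4 : 0 < √(4 * t) := Real.sqrt_pos.2 (by positivity)
    have h1 : (K + N) * √(4 * s) < M * √(4 * t) := by
      refine lt_of_pow_lt_pow_left₀ 2 (by positivity) ?_
      rw [mul_pow, mul_pow, Real.sq_sqrt (by positivity), Real.sq_sqrt (by positivity)]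
      linarith
    have h2 : (K + N) / √(4 * t) < M / √(4 * s) := (div_lt_div_iff₀ ht4 hs4).2 h1
    simp only [hG, zero_mul, ne_eq, OfNat.ofNat_ne_zero, not_false_eq_true, zero_pow, add_zero]
    rw [← add_div]
    linarith
  set A : ℝ := 2 * √t with hA
  have hA0 : 0 < A := by positivity
  have hA2 : A ^ 2 = 4 * t := by
    rw [hA, mul_pow, Real.sq_sqrt ht.le]
    norm_num
  have hlarge : ∀ n : ℝ, 1 ≤ n → 1 / (2 * A) ≤ n / √(4 * t + (A * n) ^ 2) := by
    intro n hn
    have hn0 : 0 < n := by linarith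
    rw [div_le_div_iff₀ (by positivity) (Real.sqrt_pos.2 (by positivity)), one_mul]
    refine Real.sqrt_le_iff.2 ⟨by positivity, ?_⟩
    rw [← hA2]
    nlinarith [mul_pos hA0 hA0, mul_nonneg (sq_nonneg A) (by nlinarith : 0 ≤ n ^ 2 - 1)]
  have hAm : M / √(4 * s + (A * M) ^ 2) < 1 / A := by
    rw [div_lt_div_iff₀ (Real.sqrt_pos.2 (by positivity)) hA0, one_mul]
    exact Real.lt_sqrt_of_sq_lt (by nlinarith)
  have h1 : 0 ≤ G A := by
    have e : 1 / A = 1 / (2 * A) + 1 / (2 * A) := by field_simp; norm_num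
    have := hlarge K hK
    have := hlarge N hN
    simp only [hG]
    linarith
  obtain ⟨a, ha, haG⟩ := intermediate_value_Icc hA0.le hcont.continuousOn ⟨h0.le, h1⟩
  refine ⟨a, lt_of_le_of_ne ha.1 ?_, sub_eq_zero.1 haG⟩
  rintro rfl
  exact h0.ne haG

end Cylinder

theorem proposition4p1 :
    ∀ η ε : ℝ, 0 < η → 0 < ε →
      ∃ ρ : ℝ, 0 < ρ ∧ ∀ h R : ℝ, 0 < R → h / R = ρ →
        ∃ k m n : Cylinder.Mode h R,
          -- the triad is a strict three-wave resonance
          (k, m, n) ∈ Cylinder.strictResonances h R ∧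
          -- the signs in the resonance relation are those given by the polarities
          (k.n₃ : ℝ) / k.lam + (m.n₃ : ℝ) / m.lam = (n.n₃ : ℝ) / n.lam ∧
          -- small scales
          1 / η ^ 2 ≤ k.normSq ∧ 1 / η ^ 2 ≤ m.normSq ∧ 1 / η ^ 2 ≤ n.normSq ∧
          -- ordering, opposite polarities, scale separation
          m.lam < k.lam ∧ n.lam < m.lam ∧ k.lam * n.lam < 0 ∧
          |m.lam| ≤ ε * k.lam ∧ |(|n.lam| / k.lam) - 1| ≤ ε := by
  intro η ε hη hε
  -- The axial wave numbers are `k₃ = (l + 1) M`, `m₃ = -M`, `n₃ = l M`: large `M` makes the scales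
  -- small, large `l` separates them.
  obtain ⟨M, hM⟩ : ∃ M : ℕ, 1 / η + 1 ≤ M := ⟨_, Nat.le_ceil _⟩
  obtain ⟨l, hl⟩ : ∃ l : ℕ, 1 / ε + 1 ≤ l := ⟨_, Nat.le_ceil _⟩
  have hη' : 0 < 1 / η := by positivity
  have hε' : 0 < 1 / ε := by positivity
  have hM1 : (1 : ℝ) ≤ M := by linarith
  have hl1 : (1 : ℝ) ≤ l := by linarith
  have hN1 : (1 : ℝ) ≤ l * M := one_le_mul_of_one_le_of_one_le hl1 hM1
  have hK1 : (1 : ℝ) ≤ (l + 1) * M := by linarith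
  have hlε : 1 ≤ ε * (l + 1) := by
    rw [← div_le_iff₀' hε]
    linarith
  obtain ⟨s, hs, hsz⟩ := Cylinder.exists_besselEntire_one_eq_zero 0
  obtain ⟨t, ht, htz⟩ := Cylinder.exists_besselEntire_one_eq_zero
    (((l + 1) * M + l * M) ^ 2 * s / M ^ 2)
  have ht0 : 0 < t := lt_of_le_of_lt (by positivity) ht
  have hst : (((l : ℝ) + 1) * M + l * M) ^ 2 * s < (M : ℝ) ^ 2 * t := by
    rwa [gt_iff_lt, div_lt_iff₀' (by positivity)] at ht
  obtain ⟨a, ha, hres⟩ := Cylinder.exists_resonant_axial_unit hs ht0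
    (by linarith : (0 : ℝ) < M) hN1 hK1 hst
  refine ⟨2 * Real.pi / a, by positivity, fun h R hR hρ => ?_⟩
  have hMz : (M : ℤ) ≠ 0 := by
    have : (M : ℝ) ≠ 0 := by linarith
    exact_mod_cast this
  have hlz : (l : ℤ) ≠ 0 := by
    have : (l : ℝ) ≠ 0 := by linarith
    exact_mod_cast this
  have hl1z : (l + 1 : ℤ) ≠ 0 := by positivity
  obtain ⟨k, hk2, hk3, hk⟩ := Cylinder.exists_axisymmetric_mode (σ := 1) (n₃ := (l + 1) * M) hR ha
    hρ ht0 htz (mul_ne_zero hl1z hMz) (by norm_num)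
  obtain ⟨m, hm2, hm3, hm⟩ := Cylinder.exists_axisymmetric_mode (σ := 1) (n₃ := -M) hR ha
    hρ hs hsz (neg_ne_zero.2 hMz) (by norm_num)
  obtain ⟨n, hn2, hn3, hn⟩ := Cylinder.exists_axisymmetric_mode (σ := -1) (n₃ := l * M) hR ha
    hρ ht0 htz (mul_ne_zero hlz hMz) (by norm_num)
  push_cast at hk hm hn
  rw [mul_neg, neg_sq] at hm
  set Lk := √(4 * t + (a * ((l + 1) * M)) ^ 2) with hLk
  set Lm := √(4 * s + (a * M) ^ 2) with hLm
  set Ln := √(4 * t + (a * (l * M)) ^ 2) with hLn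
  have hLk0 : 0 < Lk := Real.sqrt_pos.2 (by positivity)
  have hLm0 : 0 < Lm := Real.sqrt_pos.2 (by positivity)
  have hLn0 : 0 < Ln := Real.sqrt_pos.2 (by positivity)
  rw [one_mul] at hk hm
  have hrel : (k.n₃ : ℝ) / k.lam + (m.n₃ : ℝ) / m.lam = (n.n₃ : ℝ) / n.lam := by
    rw [hk, hm, hn, hk3, hm3, hn3]
    push_cast
    rw [div_div_eq_mul_div, div_div_eq_mul_div, div_div_eq_mul_div, neg_one_mul, div_neg]
    linear_combination R * hres
  -- The resonance relation itself forces the scale separation.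
  have hmk : (l + 1) * Lm ≤ Lk := by
    have h1 : (l + 1) * M / Lk ≤ M / Lm := by
      rw [← hres]
      exact le_add_of_nonneg_right (by positivity)
    rw [div_le_div_iff₀ hLk0 hLm0] at h1
    refine le_of_mul_le_mul_left ?_ (by linarith : (0 : ℝ) < M)
    linarith
  have hnk : Ln ≤ Lk := by
    refine Real.sqrt_le_sqrt ?_
    gcongr
    linarith
  have hkn : l * Lk ≤ (l + 1) * Ln := by
    refine (sq_le_sq₀ (by positivity) (by positivity)).1 ?_
    rw [mul_pow, mul_pow, hLk, hLn, Real.sq_sqrt (by positivity), Real.sq_sqrt (by positivity)]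
    linarith [mul_nonneg ht0.le (by linarith : (0 : ℝ) ≤ l)]
  have hscale : ∀ j : ℝ, M ≤ j → ∀ x y : ℝ, 1 / η ^ 2 ≤ x ^ 2 + y ^ 2 + j ^ 2 := by
    intro j hj x y
    have h1 : (1 / η) ^ 2 ≤ j ^ 2 := pow_le_pow_left₀ hη'.le (by linarith) 2
    rw [div_pow, one_pow] at h1
    linarith [sq_nonneg x, sq_nonneg y]
  refine ⟨k, m, n, ⟨k, m, n, rfl, ⟨1, 1, -1, ?_⟩, ?_, ?_, ?_⟩, hrel, ?_, ?_, ?_, ?_, ?_, ?_, ?_, ?_⟩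
  · push_cast
    linear_combination hrel
  · exact mul_ne_zero (mul_ne_zero k.n₃_ne_zero m.n₃_ne_zero) n.n₃_ne_zero
  · rw [hk3, hm3, hn3]
    ring
  · rw [hk2, hm2, hn2, add_zero]
  · refine hscale _ ?_ _ _
    rw [hk3]
    push_cast
    exact le_mul_of_one_le_left (by linarith) (by linarith)
  · rw [Cylinder.Mode.normSq, hm3]
    push_cast
    rw [neg_sq]
    exact hscale _ le_rfl _ _
  · refine hscale _ ?_ _ _
    rw [hn3]
    push_cast
    exact le_mul_of_one_le_left (by linarith) hl1
  · rw [hk, hm]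
    refine div_lt_div_of_pos_right (lt_of_lt_of_le ?_ hmk) hR
    exact lt_mul_of_one_lt_left hLm0 (by linarith)
  · rw [hm, hn]
    refine div_lt_div_of_pos_right ?_ hR
    linarith
  · rw [hk, hn]
    exact mul_neg_of_pos_of_neg (by positivity) (div_neg_of_neg_of_pos (by linarith) hR)
  · rw [hk, hm, abs_of_pos (by positivity), ← mul_div_assoc]
    refine div_le_div_of_nonneg_right ?_ hR.le
    calc Lm ≤ ε * (l + 1) * Lm := le_mul_of_one_le_left hLm0.le hlε
      _ = ε * ((l + 1) * Lm) := by ring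
      _ ≤ ε * Lk := mul_le_mul_of_nonneg_left hmk hε.le
  · have h1 : |n.lam| = Ln / R := by
      rw [hn, neg_one_mul, neg_div, abs_neg, abs_of_pos (by positivity)]
    rw [h1, hk, div_div_div_cancel_right₀ hR.ne']
    have h2 : Ln / Lk ≤ 1 := (div_le_one hLk0).2 hnk
    have h3 : 1 - ε ≤ Ln / Lk := by
      rw [le_div_iff₀ hLk0]
      have h4 : (l + 1) * ((1 - ε) * Lk) ≤ (l + 1) * Ln := by
        have := mul_le_mul_of_nonneg_right hlε hLk0.le
        linarith
      exact le_of_mul_le_mul_left h4 (by positivity)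
    rw [abs_le]
    constructor <;> linarith
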